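/- \textbf{Theorem (High-probability fairness violation).} \emph{Setting.} Let $(X,S,Y)$ be a random triplet with values in $\mathbb R^d\times\mathcal S\times\mathbb R$, where $\mathcal S$ is finite and non-empty; put $\pi_s=\mathbb P(S=s)$ and $\mathbb P_s=\mathbb P(\cdot\mid S=s)$. Assume $|Y|\le A$ a.s. for some $A>0$, and $\pi_{\min}:=\min_s\pi_s>0$. Let $K\ge 2$, $y_k=-A+\frac{2A}{K-1}(k-1)$ for $1\le k\le K$, and $\mathcal Y_K=\{y_1,\dots,y_K\}$. Let $M\ge1$, $0<\ell_1<\dots<\ell_M<1$, $-A\le z_1<\dots<z_M\le A$, and $a(y)=(\mathbf 1\{y\le z_m\})_{m\le M}$. Let $\mathcal D_n$ be a sample of $n$ i.i.d. copies of $(X,S,Y)$, let $\mathcal D_N=\{(X_i',S_i')\}_{i=1}^N$ ($N\ge1$) be a sample of $N$ i.i.d. copies of $(X,S)$, and let $\xi_1,\dots,\xi_N$ be i.i.d. uniform on $[0,u]$, $u\ge0$ ($\xi_i=0$ if $u=0$); $\mathcal D_n$, $\mathcal D_N$ and $(\xi_i)_i$ are independent. Let $\hat f:\mathbb R^d\times\mathcal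 S\to\mathbb R$ be a measurable regressor built from $\mathcal D_n$ by an arbitrary procedure, and for a value $\xi$ of the dither put $\bar f(x,s,\xi)=\Pi_{[-A,A]}(\hat f(x,s)+\xi)$, with $\Pi_{[-A,A]}$ the projection onto $[-A,A]$. Let $I_s=\{i:S_i'=s\}$, $N_s=|I_s|$, $\hat\pi_s=N_s/N$, and for $\lambda\in\mathbb R^{\mathcal S\times M}$ $$\widehat H(\lambda)=\sum_{s\in\mathcal S}\frac1{N_s}\sum_{i\in I_s}\max_{y\in\mathcal Y_K}\Big\{-\hat\pi_s\,(y-\bar f(X_i',s,\xi_i))^2-\langle\lambda_s,a(y)-\boldsymbol\ell\rangle\Big\}$$ (groups with $N_s=0$ contribute $0$). A \emph{post-processed predictor} is any function $\hat f_{\rm fair}(x,s,\xi)$, measurable in $(x,\xi)$, with $$\hat f_{\rm fair}(x,s,\xi)\in\operatorname*{argmin}_{y\in\mathcal Y_K}\Big\{\hat\pi_s\,(y-\bar f(x,s,\xi))^2+\langle\hat\lambda_s,a(y)\rangle\Big\},$$ where $\hat\lambda$ is some minimizer of $\widehat H$ over $\mathbb R^{\mathcal S\times M}$. Its maximal constraint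 violation is $$\mathcal U(\hat f_{\rm fair})=\max_{s\in\mathcal S}\max_{m\le M}\big|\mathbb P_s(\hat f_{\rm fair}(X,s,\xi)\le z_m)-\ell_m\big|,$$ where the sample, the $\xi_i$ and $\hat f_{\rm fair}$ are held fixed and the probability is over $X$ given $S=s$ and an independent fresh dither $\xi\sim\mathrm{Unif}([0,u])$. \emph{Claim.} There is a constant $C_{\mathcal S}>0$, depending only on $\mathcal S$ and $\pi_{\min}$, such that for every $\delta\in(0,1)$ and almost every realization of $\mathcal D_n$ for which the dithering is effective, i.e. for which (i) for every $s$, $-A<\hat f(X,s)+\xi<A$ holds $\mathbb P_s$-a.s. (the projection creates no atom at $\pm A$), and (ii) if $u=0$, then for every $s$ the function $t\mapsto\mathbb P_s(\hat f(X,s)\le t)$ is continuous, the following holds: conditionally on $\mathcal D_n$, with probability at least $1-\delta$ over $\mathcal D_N$ and $(\xi_i)_i$, every post-processed predictor satisfies $$\mathcal U(\hat f_{\rm fair})\le C_{\mathcal S}\left(\sqrt{\frac1N}+\frac{K^2}{N}+\sqrt{\frac{\log(1/\delta)}{N}}\right).$$ -/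

import Mathlib

open MeasureTheory ProbabilityTheory

namespace FairPost

noncomputable section

/-- The feature space `ℝ^d`. -/
abbrev Feat (d : ℕ) : Type := EuclideanSpace ℝ (Fin d)

/-- The uniform law on `[0, u]`, as the law of `u * V` with `V` uniform on `[0, 1]`;
for `u = 0` it is the point mass at `0` (no dithering). -/
def ditherLaw (u : ℝ) : Measure ℝ :=
  (volume.restrict (Set.Icc (0 : ℝ) 1)).map (fun v => u * v)

instance isProbabilityMeasure_ditherLaw (u : ℝ) : IsProbabilityMeasure (ditherLaw u) := by
  have : IsProbabilityMeasure (volume.restrict (Set.Icc (0 : ℝ) 1)) := ⟨by simp⟩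
  exact Measure.isProbabilityMeasure_map (by fun_prop)

/-- The point `y_{k+1} = -A + (2A/(K-1)) k` of the regular grid of `[-A, A]` with `K` points
(here `k = 0, …, K-1`). -/
def gridPt (A : ℝ) (K : ℕ) (k : Fin K) : ℝ :=
  -A + 2 * A / ((K : ℝ) - 1) * (k : ℕ)

/-- The dithered regressor `Π_{[-A,A]}(f(x,s) + ξ)`, as a function of the value `ξ` of the dither. -/
def dithered {d : ℕ} {S : Type*} (A : ℝ) (f : Feat d → S → ℝ) (x : Feat d) (s : S) (ξ : ℝ) : ℝ :=
  max (-A) (min A (f x s + ξ))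

/-- `a(y)_m = 1{y ≤ z_m}`. -/
def thresholdVec {M : ℕ} (z : Fin M → ℝ) (y : ℝ) (m : Fin M) : ℝ :=
  if y ≤ z m then 1 else 0

section Population

variable {Ω S : Type*} [MeasurableSpace Ω] {d M : ℕ}

/-- `π_s = ℙ(G = s)`, where `G` is the sensitive attribute. -/
def groupProb (μ : Measure Ω) (G : Ω → S) (s : S) : ℝ := μ.real (G ⁻¹' {s})

/-- The law `ℙ_s` of `(X, ξ)` given `G = s`, where `ξ ∼ Unif[0,u]` is the dither of the point at
which a prediction is made, independent of `(X, G)`. -/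
def groupLaw (μ : Measure Ω) (X : Ω → Feat d) (G : Ω → S) (u : ℝ) (s : S) :
    Measure (Feat d × ℝ) :=
  ((ProbabilityTheory.cond μ (G ⁻¹' {s})).map X).prod (ditherLaw u)

/-- The maximal constraint violation `max_s max_m |ℙ_s(g(X,s) ≤ z_m) - ℓ_m|` of a (randomized)
predictor `g(x, s, ξ)`. -/
def violation (μ : Measure Ω) (X : Ω → Feat d) (G : Ω → S) (u : ℝ) (l z : Fin M → ℝ)
    (g : Feat d → S → ℝ → ℝ) : ℝ :=
  ⨆ s : S, ⨆ m : Fin M, |(groupLaw μ X G u s).real {p | g p.1 s p.2 ≤ z m} - l m|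

/-- The dither removes the ties of `f`: in each group, `f(X,s) + ξ` almost surely needs no
projection onto `[-A, A]` (so that the projection creates no atom at `±A`), and, if there is no
dither, then `f(X,s)` has a continuous distribution function. -/
def DitherRegular (μ : Measure Ω) (X : Ω → Feat d) (G : Ω → S) (A u : ℝ)
    (f : Feat d → S → ℝ) : Prop :=
  (∀ s, ∀ᵐ p ∂(groupLaw μ X G u s), f p.1 s + p.2 ∈ Set.Ioo (-A) A) ∧
  (u = 0 → ∀ s, Continuous fun t : ℝ => (groupLaw μ X G u s).real {p | f p.1 s ≤ t})

end Population

section Empirical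

variable {S : Type*} [DecidableEq S] {d N M : ℕ}

/-- `I_s = {i : S'_i = s}`. -/
def groupIdx (D : Fin N → Feat d × S) (s : S) : Finset (Fin N) :=
  Finset.univ.filter fun i => (D i).2 = s

/-- `π̂_s = N_s / N`. -/
def empWeight (D : Fin N → Feat d × S) (s : S) : ℝ := ((groupIdx D s).card : ℝ) / N

/-- The empirical dual score `-π̂_s (y - t)² - ⟨λ_s, a(y) - ℓ⟩`, where `t` is the value of the
dithered regressor. -/
def empScore (D : Fin N → Feat d × S) (l z : Fin M → ℝ) (lam : S → Fin M → ℝ)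
    (s : S) (t y : ℝ) : ℝ :=
  -(empWeight D s * (y - t) ^ 2) - ∑ m, lam s m * (thresholdVec z y m - l m)

/-- The empirical dual objective
`Ĥ(λ) = ∑_s (1/N_s) ∑_{i ∈ I_s} max_{y ∈ 𝒴_K} Φ̂_{s,λ}(X'_i, y)`, the `i`-th calibration point being
dithered by `ξ i`. A group without calibration points contributes `0`. -/
def empDual [Fintype S] (A : ℝ) (K : ℕ) (f : Feat d → S → ℝ) (D : Fin N → Feat d × S)
    (ξ : Fin N → ℝ) (l z : Fin M → ℝ) (lam : S → Fin M → ℝ) : ℝ :=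
  ∑ s : S, 1 / ((groupIdx D s).card : ℝ) *
    ∑ i ∈ groupIdx D s,
      ⨆ k : Fin K, empScore D l z lam s (dithered A f (D i).1 s (ξ i)) (gridPt A K k)

/-- `g` is a post-processed predictor: for some minimizer `λ̂` of the empirical dual objective over
`ℝ^{S × M}`, it is a measurable selection
`g(x,s,ξ) ∈ argmin_{y ∈ 𝒴_K} { π̂_s (y - f̄(x,s,ξ))² + ⟨λ̂_s, a(y)⟩ }`. -/
def IsPostProcessed [Fintype S] (A : ℝ) (K : ℕ) (f : Feat d → S → ℝ) (D : Fin N → Feat d × S)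
    (ξ : Fin N → ℝ) (l z : Fin M → ℝ) (g : Feat d → S → ℝ → ℝ) : Prop :=
  ∃ lam : S → Fin M → ℝ,
    (∀ lam' : S → Fin M → ℝ, empDual A K f D ξ l z lam ≤ empDual A K f D ξ l z lam') ∧
    (∀ s, Measurable fun p : Feat d × ℝ => g p.1 s p.2) ∧
    ∀ x s t, g x s t ∈ Set.range (gridPt A K) ∧
      ∀ k : Fin K,
        empWeight D s * (g x s t - dithered A f x s t) ^ 2
            + ∑ m, lam s m * thresholdVec z (g x s t) m ≤
          empWeight D s * (gridPt A K k - dithered A f x s t) ^ 2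
            + ∑ m, lam s m * thresholdVec z (gridPt A K k) m

end Empirical

end

end FairPost

namespace FairPost

/-! Fix a group `s` and a threshold `z m`. The difference of the scores of two grid points is affine
in the regressor value `t`, with a slope whose sign is fixed by their order, whatever the multiplier
is. Hence there is a cutoff `τ`, depending on the calibration data, such that the predictor is at
most `z m` when the dithered value is below `τ` and exceeds `z m` when it is above; ties matter only
at `τ` itself (`exists_forall_lt_of_weak`).

The one-sided derivatives of the empirical dual along the coordinate `(s, m)` show that the number
of calibration points below `τ` is at most `N_s ℓ_m`, and the number at or below `τ` at least `N_s
ℓ_m` (`card_strict_le`, `le_card_weak`). Because the dithered value has a continuous distribution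
function, the value `τ` carries no mass, and the violation is controlled by the deviations of
empirical counts over half-lines and of the group size (`abs_measureReal_sub_le`).

As `τ` is random, these deviations must be uniform over half-lines. Half-lines form a chain, so a
Dvoretzky–Kiefer–Wolfowitz type bound holds without logarithmic factor (`measure_pi_exists_lt_le`):
a ghost sample and random signs reduce it to Lévy's maximal inequality. A union bound over the
groups concludes. The argument never depends on the grid size, so `K² / N` is pure slack in the
final bound. -/

/-- The sign `±1` encoded by a Boolean. -/
def boolSign (b : Bool) : ℝ := if b then 1 else -1

/-! ### Maximal inequality for sums of random signs. -/

section Signs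

variable {κ ι : Type*} [Fintype κ]

theorem boolSign_not (b : Bool) : boolSign (!b) = -boolSign b := by
  cases b <;> simp [boolSign]

theorem sum_exp_sum_boolSign_le [DecidableEq κ] (t : ℝ) :
    ∑ σ : κ → Bool, Real.exp (t * ∑ i, boolSign (σ i)) ≤
      2 ^ Fintype.card κ * Real.exp (Fintype.card κ * (t ^ 2 / 2)) := by
  have h : ∑ σ : κ → Bool, Real.exp (t * ∑ i, boolSign (σ i)) =
      ∏ _i : κ, ∑ b : Bool, Real.exp (t * boolSign b) := by
    rw [Finset.prod_univ_sum, Fintype.piFinset_univ]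
    refine Finset.sum_congr rfl fun σ _ => ?_
    rw [Finset.mul_sum, Real.exp_sum]
  rw [h, Finset.prod_const, Finset.card_univ, Real.exp_nat_mul, ← mul_pow]
  have h2 := Real.cosh_le_exp_half_sq t
  rw [Real.cosh_eq] at h2
  gcongr
  simp only [Fintype.sum_bool, boolSign, if_true, Bool.false_eq_true, if_false, mul_one, mul_neg]
  linarith

-- Chernoff's bound, with counting measure on sign vectors in place of a probability. The factor `c
-- = ±1` serves both tails.
open Classical in
theorem card_le_sum_boolSign_le (c : ℝ) (hc : c = 1 ∨ c = -1) {a : ℝ} (ha : 0 ≤ a) :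
    ((Finset.univ.filter fun σ : κ → Bool => a < c * ∑ i, boolSign (σ i)).card : ℝ) ≤
      2 ^ Fintype.card κ * Real.exp (-(a ^ 2) / (2 * Fintype.card κ)) := by
  rcases Nat.eq_zero_or_pos (Fintype.card κ) with h0 | hpos
  · have : IsEmpty κ := Fintype.card_eq_zero_iff.1 h0
    simp [not_lt.2 ha]
  set n : ℝ := (Fintype.card κ : ℝ) with hn
  have hn0 : 0 < n := Nat.cast_pos.2 hpos
  -- The minimizer of `n t² / 2 - t a`.
  set t : ℝ := a / n with ht
  have ht0 : 0 ≤ t := by positivity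
  have h1 : ((Finset.univ.filter fun σ : κ → Bool => a < c * ∑ i, boolSign (σ i)).card : ℝ) *
      Real.exp (t * a) ≤ ∑ σ : κ → Bool, Real.exp (t * c * ∑ i, boolSign (σ i)) := by
    rw [← nsmul_eq_mul, ← Finset.sum_const]
    refine (Finset.sum_le_sum fun σ hσ => ?_).trans
      (Finset.sum_le_sum_of_subset_of_nonneg (Finset.filter_subset _ _) fun _ _ _ =>
        (Real.exp_pos _).le)
    rw [Real.exp_le_exp, mul_assoc]
    exact mul_le_mul_of_nonneg_left (Finset.mem_filter.1 hσ).2.le ht0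
  have h2 := h1.trans (sum_exp_sum_boolSign_le (t * c))
  have hc2 : c ^ 2 = 1 := by rcases hc with rfl | rfl <;> norm_num
  have h3 : Real.exp (n * ((t * c) ^ 2 / 2)) = Real.exp (-(a ^ 2) / (2 * n)) * Real.exp (t * a) := by
    rw [← Real.exp_add]
    congr 1
    rw [mul_pow, hc2, ht]
    field_simp
    ring
  rw [h3, ← mul_assoc] at h2
  exact le_of_mul_le_mul_right h2 (Real.exp_pos _)

open Classical in
theorem card_abs_sum_boolSign_le {a : ℝ} (ha : 0 ≤ a) :
    ((Finset.univ.filter fun σ : κ → Bool => a < |∑ i, boolSign (σ i)|).card : ℝ) ≤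
      2 ^ Fintype.card κ * (2 * Real.exp (-(a ^ 2) / (2 * Fintype.card κ))) := by
  have hsub : (Finset.univ.filter fun σ : κ → Bool => a < |∑ i, boolSign (σ i)|) ⊆
      (Finset.univ.filter fun σ : κ → Bool => a < 1 * ∑ i, boolSign (σ i)) ∪
        (Finset.univ.filter fun σ : κ → Bool => a < (-1) * ∑ i, boolSign (σ i)) := by
    intro σ
    simp only [Finset.mem_filter, Finset.mem_univ, true_and, Finset.mem_union, lt_abs]
    rintro (h | h)
    · left; linarith
    · right; linarith
  have h := (Finset.card_le_card hsub).trans (Finset.card_union_le _ _)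
  have h' : ((Finset.univ.filter fun σ : κ → Bool => a < |∑ i, boolSign (σ i)|).card : ℝ) ≤
      (Finset.univ.filter fun σ : κ → Bool => a < 1 * ∑ i, boolSign (σ i)).card +
        (Finset.univ.filter fun σ : κ → Bool => a < (-1) * ∑ i, boolSign (σ i)).card := by
    exact_mod_cast h
  have h1 := card_le_sum_boolSign_le (κ := κ) 1 (Or.inl rfl) ha
  have h2 := card_le_sum_boolSign_le (κ := κ) (-1) (Or.inr rfl) ha
  linarith

open Classical in
/-- Lévy's reflection principle for sums of signs over a finite chain of index sets. -/
theorem card_exists_abs_sum_boolSign_le [LinearOrder ι] [Fintype ι] {A : ι → Finset κ}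
    (hA : Monotone A) (a : ℝ) :
    (Finset.univ.filter fun σ : κ → Bool => ∃ j, a < |∑ i ∈ A j, boolSign (σ i)|).card ≤
      2 * (Finset.univ.filter fun σ : κ → Bool => a < |∑ i, boolSign (σ i)|).card := by
  set G := Finset.univ.filter fun σ : κ → Bool => a < |∑ i, boolSign (σ i)|
  -- The level `a` is exceeded for the first time at `j`; these events are disjoint.
  set B : ι → Finset (κ → Bool) := fun j => Finset.univ.filter fun σ : κ → Bool =>
    a < |∑ i ∈ A j, boolSign (σ i)| ∧ ∀ k < j, |∑ i ∈ A k, boolSign (σ i)| ≤ a with hB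
  -- Reflection after time `j`: it preserves membership in `B j`, which depends only on the signs in
  -- `A j`.
  let flip : ι → (κ → Bool) → κ → Bool := fun j σ i => if i ∈ A j then σ i else !(σ i)
  have hflip_inj : ∀ j, Function.Injective (flip j) := by
    intro j
    refine Function.Involutive.injective fun σ => ?_
    funext i
    by_cases hi : i ∈ A j <;> simp [flip, hi]
  have hflip_in : ∀ j, ∀ k ≤ j, ∀ σ, ∑ i ∈ A k, boolSign (flip j σ i) =
      ∑ i ∈ A k, boolSign (σ i) := by
    intro j k hk σ
    refine Finset.sum_congr rfl fun i hi => ?_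
    simp [flip, hA hk hi]
  have hflip_out : ∀ j σ, ∑ i ∈ (A j)ᶜ, boolSign (flip j σ i) =
      -∑ i ∈ (A j)ᶜ, boolSign (σ i) := by
    intro j σ
    rw [← Finset.sum_neg_distrib]
    refine Finset.sum_congr rfl fun i hi => ?_
    simp [flip, Finset.mem_compl.1 hi, boolSign_not]
  have hBsub : ∀ j, (B j).card ≤ 2 * (B j ∩ G).card := by
    intro j
    have hsub : B j ⊆ (B j ∩ G) ∪ (B j ∩ G).preimage (flip j) (hflip_inj j).injOn := by
      intro σ hσ
      have hσ' := (Finset.mem_filter.1 hσ).2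
      simp only [Finset.mem_union, Finset.mem_inter, Finset.mem_preimage, hσ, true_and]
      have h1 := Finset.sum_add_sum_compl (A j) fun i => boolSign (σ i)
      have h2 := Finset.sum_add_sum_compl (A j) fun i => boolSign (flip j σ i)
      rw [hflip_out, hflip_in j j le_rfl] at h2
      have hfB : flip j σ ∈ B j := by
        refine Finset.mem_filter.2 ⟨Finset.mem_univ _, ?_, fun k hk => ?_⟩
        · rw [hflip_in j j le_rfl]; exact hσ'.1
        · rw [hflip_in j k hk.le]; exact hσ'.2 k hk
      simp only [hfB, true_and, G, Finset.mem_filter, Finset.mem_univ]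
      -- The sum over `A j` is the average of the full sums before and after reflection, so one of
      -- the two exceeds `a` in absolute value.
      by_contra! hcon
      rw [← h1, ← h2] at hcon
      have h3 := hσ'.1
      obtain ⟨h4, h5⟩ := hcon
      rw [abs_le] at h4 h5
      rw [lt_abs] at h3
      rcases h3 with h3 | h3 <;> linarith [h4.1, h4.2, h5.1, h5.2]
    refine (Finset.card_le_card hsub).trans ((Finset.card_union_le _ _).trans ?_)
    have : ((B j ∩ G).preimage (flip j) (hflip_inj j).injOn).card ≤ (B j ∩ G).card :=
      Finset.card_le_card_of_injOn (flip j) (fun σ hσ => Finset.mem_preimage.1 hσ)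
        (hflip_inj j).injOn
    omega
  have hdisj : (Set.univ : Set ι).PairwiseDisjoint fun j => B j ∩ G := by
    intro j _ k _ hjk
    refine Finset.disjoint_left.2 fun σ h1 h2 => ?_
    have h1' := (Finset.mem_filter.1 (Finset.mem_inter.1 h1).1).2
    have h2' := (Finset.mem_filter.1 (Finset.mem_inter.1 h2).1).2
    rcases lt_or_gt_of_ne hjk with h | h
    · exact absurd h1'.1 (not_lt.2 (h2'.2 j h))
    · exact absurd h2'.1 (not_lt.2 (h1'.2 k h))
  have hcover : (Finset.univ.filter fun σ : κ → Bool => ∃ j, a < |∑ i ∈ A j, boolSign (σ i)|) ⊆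
      Finset.univ.biUnion B := by
    intro σ hσ
    obtain ⟨j0, hj0⟩ := (Finset.mem_filter.1 hσ).2
    obtain ⟨j, hj⟩ := Finset.exists_minimal
      (s := Finset.univ.filter fun j => a < |∑ i ∈ A j, boolSign (σ i)|)
      ⟨j0, by simpa using hj0⟩
    refine Finset.mem_biUnion.2 ⟨j, Finset.mem_univ _, Finset.mem_filter.2
      ⟨Finset.mem_univ _, (Finset.mem_filter.1 hj.1).2, fun k hk => ?_⟩⟩
    by_contra! hcon
    exact absurd (hj.2 (Finset.mem_filter.2 ⟨Finset.mem_univ k, hcon⟩) hk.le) (not_le.2 hk)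
  calc _ ≤ (Finset.univ.biUnion B).card := Finset.card_le_card hcover
    _ ≤ ∑ j, (B j).card := Finset.card_biUnion_le
    _ ≤ ∑ j, 2 * (B j ∩ G).card := Finset.sum_le_sum fun j _ => hBsub j
    _ = 2 * (Finset.univ.biUnion fun j => B j ∩ G).card := by
      rw [← Finset.mul_sum, Finset.card_biUnion fun j _ k _ h => hdisj trivial trivial h]
    _ ≤ 2 * G.card := by
      gcongr
      exact Finset.biUnion_subset.2 fun j _ => Finset.inter_subset_right

open Classical in
theorem card_exists_abs_sum_boolSign_le_exp [LinearOrder ι] [Fintype ι] {A : ι → Finset κ}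
    (hA : Monotone A) {a : ℝ} (ha : 0 ≤ a) :
    ((Finset.univ.filter fun σ : κ → Bool => ∃ j, a < |∑ i ∈ A j, boolSign (σ i)|).card : ℝ) ≤
      2 ^ Fintype.card κ * (4 * Real.exp (-(a ^ 2) / (2 * Fintype.card κ))) := by
  have h1 : ((Finset.univ.filter fun σ : κ → Bool =>
      ∃ j, a < |∑ i ∈ A j, boolSign (σ i)|).card : ℝ) ≤
      2 * (Finset.univ.filter fun σ : κ → Bool => a < |∑ i, boolSign (σ i)|).card := by
    exact_mod_cast card_exists_abs_sum_boolSign_le hA a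
  have h2 := card_abs_sum_boolSign_le (κ := κ) ha
  linarith

end Signs

/-! ### Symmetrization and uniform deviations over a chain of sets. -/

section Symmetrization

open Classical in
/-- If a finite family of measure-preserving maps sends every point into `B` in at most a
fraction `c` of the cases, then `B` has measure at most `c`. -/
theorem measureReal_le_of_card_le {β κ' : Type*} [MeasurableSpace β] [Fintype κ'] [Nonempty κ']
    {ρ : Measure β} [IsProbabilityMeasure ρ] {T : κ' → β → β}
    (hT : ∀ σ, MeasurePreserving (T σ) ρ ρ) {B : Set β} (hB : MeasurableSet B) {c : ℝ}
    (h : ∀ w, ((Finset.univ.filter fun σ => T σ w ∈ B).card : ℝ) ≤ Fintype.card κ' * c) :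
    ρ.real B ≤ c := by
  have hcard : (0 : ℝ) < Fintype.card κ' := Nat.cast_pos.2 Fintype.card_pos
  have hTB : ∀ σ, MeasurableSet (T σ ⁻¹' B) := fun σ => (hT σ).measurable hB
  have h1 : Fintype.card κ' * ρ.real B =
      ∫ w, ∑ σ : κ', (T σ ⁻¹' B).indicator (fun _ => (1 : ℝ)) w ∂ρ := by
    rw [integral_finsetSum _ fun σ _ => (integrable_const _).indicator (hTB σ)]
    have : ∀ σ, ∫ w, (T σ ⁻¹' B).indicator (fun _ => (1 : ℝ)) w ∂ρ = ρ.real B := by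
      intro σ
      rw [integral_indicator_const _ (hTB σ), smul_eq_mul, mul_one, measureReal_def,
        (hT σ).measure_preimage hB.nullMeasurableSet, measureReal_def]
    simp [this]
  have h2 : ∫ w, ∑ σ : κ', (T σ ⁻¹' B).indicator (fun _ => (1 : ℝ)) w ∂ρ ≤
      ∫ _w, Fintype.card κ' * c ∂ρ := by
    refine integral_mono (integrable_finsetSum _ fun σ _ =>
      (integrable_const _).indicator (hTB σ)) (integrable_const _) fun w => ?_
    refine le_trans (le_of_eq ?_) (h w)
    simp [Set.indicator_apply, Finset.sum_boole]
  rw [← h1] at h2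
  simp only [integral_const, probReal_univ, one_smul] at h2
  exact le_of_mul_le_mul_left h2 hcard

/-- Symmetrization by a ghost sample. -/
theorem measureReal_exists_lt_abs_le_two_mul_prod {β ι : Type*} [MeasurableSpace β] [Countable ι]
    {P : Measure β} [IsProbabilityMeasure P] {D : ι → β → ℝ} (hD : ∀ j, Measurable (D j)) {a : ℝ}
    (h : ∀ j, P.real {x | a / 2 < |D j x|} ≤ 1 / 2) :
    P.real {x | ∃ j, a < |D j x|} ≤
      2 * (P.prod P).real {p | ∃ j, a / 2 < |D j p.1 - D j p.2|} := by
  set B₁ := {x | ∃ j, a < |D j x|}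
  set B₂ := {p : β × β | ∃ j, a / 2 < |D j p.1 - D j p.2|}
  have hB₁ : MeasurableSet B₁ := by
    have : B₁ = ⋃ j, {x | a < |D j x|} := by ext; simp [B₁]
    rw [this]
    exact MeasurableSet.iUnion fun j => measurableSet_lt measurable_const (hD j).norm
  have hB₂ : MeasurableSet B₂ := by
    have : B₂ = ⋃ j, {p : β × β | a / 2 < |D j p.1 - D j p.2|} := by ext; simp [B₂]
    rw [this]
    exact MeasurableSet.iUnion fun j => measurableSet_lt measurable_const
      (((hD j).comp measurable_fst).sub ((hD j).comp measurable_snd)).norm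
  have hsec : ∀ x ∈ B₁, ENNReal.ofReal (1 / 2) ≤ P (Prod.mk x ⁻¹' B₂) := by
    rintro x ⟨j, hj⟩
    have hm : MeasurableSet {x | a / 2 < |D j x|} :=
      measurableSet_lt measurable_const (hD j).norm
    -- The index `j` was chosen from `x` alone, so the pointwise bound `h j` applies to the
    -- independent ghost point.
    have hsub : {x | a / 2 < |D j x|}ᶜ ⊆ Prod.mk x ⁻¹' B₂ := by
      intro y hy
      simp only [Set.mem_compl_iff, Set.mem_ofPred_eq, not_lt] at hy
      refine ⟨j, ?_⟩
      have := abs_sub_abs_le_abs_sub (D j x) (D j y)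
      dsimp only
      linarith
    have h1 := measureReal_mono (μ := P) hsub
    rw [probReal_compl_eq_one_sub hm] at h1
    rw [← ofReal_measureReal]
    exact ENNReal.ofReal_le_ofReal (by linarith [h j])
  have hmain : ENNReal.ofReal (1 / 2) * P B₁ ≤ (P.prod P) B₂ := by
    rw [Measure.prod_apply hB₂, ← setLIntegral_const, ← lintegral_indicator hB₁]
    refine lintegral_mono fun x => ?_
    by_cases hx : x ∈ B₁
    · simpa [hx] using hsec x hx
    · simp [hx]
  have := ENNReal.toReal_mono (measure_ne_top _ _) hmain
  rw [ENNReal.toReal_mul, ENNReal.toReal_ofReal (by norm_num)] at this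
  simp only [measureReal_def]
  linarith

open Classical in
theorem sum_mul_indicator_eq {α κ : Type*} [Fintype κ] (E : Set α) (x : κ → α) (f : κ → ℝ) :
    ∑ i, f i * E.indicator (fun _ => (1 : ℝ)) (x i) =
      ∑ i ∈ Finset.univ.filter (fun i => x i ∈ E), f i := by
  simp [Set.indicator_apply, Finset.sum_filter]

open Classical in
theorem card_exists_signed_indicator_le {α κ ι : Type*} [Fintype κ] [LinearOrder ι] [Fintype ι]
    {E : ι → Set α} (hE : Monotone E) (x : κ → α) {a : ℝ} (ha : 0 ≤ a) :
    ((Finset.univ.filter fun σ : κ → Bool =>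
      ∃ j, a < |∑ i, boolSign (σ i) * (E j).indicator (fun _ => (1 : ℝ)) (x i)|).card : ℝ) ≤
      2 ^ Fintype.card κ * (4 * Real.exp (-(a ^ 2) / (2 * Fintype.card κ))) := by
  simp only [sum_mul_indicator_eq]
  refine card_exists_abs_sum_boolSign_le_exp (fun j k hjk i hi => ?_) ha
  simp only [Finset.mem_filter, Finset.mem_univ, true_and] at hi ⊢
  exact hE hjk hi

variable {α κ : Type*} [MeasurableSpace α] [Fintype κ]

theorem measurable_sum_indicator {E : Set α} (hE : MeasurableSet E) :
    Measurable fun x : κ → α => ∑ i, E.indicator (fun _ => (1 : ℝ)) (x i) :=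
  Finset.measurable_sum _ fun i _ =>
    (measurable_const.indicator hE).comp (measurable_pi_apply i)

/-- Chebyshev's inequality, each indicator having variance at most `1 / 4`. It supplies the one-half
hypothesis of the symmetrization step. -/
theorem measureReal_pi_lt_abs_sum_indicator_le (η : Measure α) [IsProbabilityMeasure η]
    {E : Set α} (hE : MeasurableSet E) {a : ℝ} (ha : 0 < a) :
    (Measure.pi fun _ : κ => η).real
      {x | a < |∑ i, E.indicator (fun _ => (1 : ℝ)) (x i) - Fintype.card κ * η.real E|} ≤
      Fintype.card κ / (4 * a ^ 2) := by
  set P := Measure.pi fun _ : κ => η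
  set X : (κ → α) → ℝ := fun x => ∑ i, E.indicator (fun _ => (1 : ℝ)) (x i)
  have hXmeas : Measurable X := measurable_sum_indicator hE
  have hind : Measurable (E.indicator (fun _ => (1 : ℝ))) := measurable_const.indicator hE
  have hbd : ∀ y, E.indicator (fun _ => (1 : ℝ)) y ∈ Set.Icc (0 : ℝ) 1 := by
    intro y
    by_cases hy : y ∈ E <;> simp [hy]
  have hmem : MemLp (E.indicator (fun _ => (1 : ℝ))) 2 η :=
    MemLp.of_bound hind.aestronglyMeasurable 1 (Filter.Eventually.of_forall fun y => by
      rw [Real.norm_eq_abs, abs_of_nonneg (hbd y).1]; exact (hbd y).2)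
  have hXfun : X = ∑ i, fun x : κ → α => E.indicator (fun _ => (1 : ℝ)) (x i) := by
    ext x; simp [X]
  have hmemX : MemLp X 2 P := by
    rw [hXfun]
    exact memLp_finsetSum' _ fun i _ => hmem.comp_measurePreserving (measurePreserving_eval _ i)
  have hvar : variance X P ≤ Fintype.card κ / 4 := by
    rw [hXfun, variance_sum_pi (X := fun _ => E.indicator (fun _ => (1 : ℝ))) fun _ => hmem,
      Finset.sum_const, Finset.card_univ, nsmul_eq_mul]
    have := variance_le_sq_of_bounded (Filter.Eventually.of_forall hbd) hind.aemeasurable (μ := η)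
    have hc : (0 : ℝ) ≤ Fintype.card κ := Nat.cast_nonneg _
    nlinarith
  have hmean : ∫ x, X x ∂P = Fintype.card κ * η.real E := by
    have hi : ∀ i, ∫ x : κ → α, E.indicator (fun _ => (1 : ℝ)) (x i) ∂P = η.real E := by
      intro i
      have h1 := (measurePreserving_eval (fun _ : κ => η) i).map_eq
      calc ∫ x : κ → α, E.indicator (fun _ => (1 : ℝ)) (x i) ∂P
          = ∫ y, E.indicator (fun _ => (1 : ℝ)) y ∂(P.map (Function.eval i)) :=
            (integral_map (measurable_pi_apply i).aemeasurable hind.aestronglyMeasurable).symm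
        _ = η.real E := by rw [h1, integral_indicator_const _ hE, smul_eq_mul, mul_one]
    rw [integral_finsetSum]
    · simp [hi]
    · exact fun i _ => (hmem.comp_measurePreserving
        (measurePreserving_eval _ i)).integrable (by norm_num)
  have hcheb := meas_ge_le_variance_div_sq hmemX ha
  rw [hmean] at hcheb
  have hmono : P {x | a < |X x - Fintype.card κ * η.real E|} ≤
      P {x | a ≤ |X x - Fintype.card κ * η.real E|} := measure_mono fun x hx =>
      (show a < |X x - Fintype.card κ * η.real E| from hx).le
  have := ENNReal.toReal_mono ENNReal.ofReal_ne_top (hmono.trans hcheb)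
  rw [ENNReal.toReal_ofReal (div_nonneg (variance_nonneg _ _) (sq_nonneg _))] at this
  refine this.trans ?_
  calc variance X P / a ^ 2 ≤ (Fintype.card κ / 4) / a ^ 2 := by gcongr
    _ = _ := by rw [div_div]

/-- The tail bound for the difference of the empirical counts of two independent samples, uniformly
over a finite chain of sets. -/
theorem measureReal_pi_prod_exists_lt_le {ι : Type*} [LinearOrder ι] [Fintype ι]
    (η : Measure α) [IsProbabilityMeasure η] {E : ι → Set α} (hE : Monotone E)
    (hm : ∀ j, MeasurableSet (E j)) {a : ℝ} (ha : 0 ≤ a) :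
    (Measure.pi fun _ : κ => η.prod η).real
      {w | ∃ j, a < |∑ i, ((E j).indicator (fun _ => (1 : ℝ)) (w i).1 -
        (E j).indicator (fun _ => (1 : ℝ)) (w i).2)|} ≤
      8 * Real.exp (-((a / 2) ^ 2) / (2 * Fintype.card κ)) := by
  classical
  -- Exchanging a point with its ghost preserves the product law and changes the sign of its
  -- contribution.
  let T : (κ → Bool) → (κ → α × α) → κ → α × α := fun σ w i => if σ i then w i else (w i).swap
  have hT : ∀ σ, MeasurePreserving (T σ) (Measure.pi fun _ : κ => η.prod η)
      (Measure.pi fun _ : κ => η.prod η) := by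
    intro σ
    refine measurePreserving_pi (fun _ : κ => η.prod η) (fun _ : κ => η.prod η)
      (f := fun i p => if σ i then p else p.swap) fun i => ?_
    cases σ i
    · simpa using Measure.measurePreserving_swap (μ := η) (ν := η)
    · exact MeasurePreserving.id _
  have hind : ∀ j, Measurable ((E j).indicator (fun _ => (1 : ℝ))) := fun j =>
    measurable_const.indicator (hm j)
  refine measureReal_le_of_card_le hT ?_ fun w => ?_
  · have : {w : κ → α × α | ∃ j, a < |∑ i, ((E j).indicator (fun _ => (1 : ℝ)) (w i).1 -
        (E j).indicator (fun _ => (1 : ℝ)) (w i).2)|} =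
        ⋃ j, {w | a < |∑ i, ((E j).indicator (fun _ => (1 : ℝ)) (w i).1 -
        (E j).indicator (fun _ => (1 : ℝ)) (w i).2)|} := by ext; simp
    rw [this]
    refine MeasurableSet.iUnion fun j => measurableSet_lt measurable_const
      (continuous_abs.measurable.comp ?_)
    exact Finset.measurable_sum _ fun i _ =>
      ((hind j).comp (measurable_fst.comp (measurable_pi_apply i))).sub
        ((hind j).comp (measurable_snd.comp (measurable_pi_apply i)))
  · have hTw : ∀ σ j, ∑ i, ((E j).indicator (fun _ => (1 : ℝ)) (T σ w i).1 -
        (E j).indicator (fun _ => (1 : ℝ)) (T σ w i).2) =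
        ∑ i, boolSign (σ i) * (E j).indicator (fun _ => (1 : ℝ)) (w i).1 -
          ∑ i, boolSign (σ i) * (E j).indicator (fun _ => (1 : ℝ)) (w i).2 := by
      intro σ j
      rw [← Finset.sum_sub_distrib]
      refine Finset.sum_congr rfl fun i _ => ?_
      cases h : σ i <;> simp [T, h, boolSign]
      ring
    -- A signed difference above `a` forces one of the two signed sums above `a / 2`; the two
    -- maximal inequalities turn the factor `4` into `8`.
    have hsub : (Finset.univ.filter fun σ => T σ w ∈ {w : κ → α × α | ∃ j,
        a < |∑ i, ((E j).indicator (fun _ => (1 : ℝ)) (w i).1 -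
          (E j).indicator (fun _ => (1 : ℝ)) (w i).2)|}) ⊆
        (Finset.univ.filter fun σ : κ → Bool => ∃ j,
          a / 2 < |∑ i, boolSign (σ i) * (E j).indicator (fun _ => (1 : ℝ)) ((w i).1)|) ∪
        (Finset.univ.filter fun σ : κ → Bool => ∃ j,
          a / 2 < |∑ i, boolSign (σ i) * (E j).indicator (fun _ => (1 : ℝ)) ((w i).2)|) := by
      intro σ hσ
      obtain ⟨j, hj⟩ := (Finset.mem_filter.1 hσ).2
      rw [hTw] at hj
      simp only [Finset.mem_union, Finset.mem_filter, Finset.mem_univ, true_and]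
      by_contra! hcon
      have := abs_sub (∑ i, boolSign (σ i) * (E j).indicator (fun _ => (1 : ℝ)) (w i).1)
        (∑ i, boolSign (σ i) * (E j).indicator (fun _ => (1 : ℝ)) (w i).2)
      linarith [hcon.1 j, hcon.2 j]
    have h0 := (Finset.card_le_card hsub).trans (Finset.card_union_le _ _)
    have h1 := card_exists_signed_indicator_le hE (fun i => (w i).1) (div_nonneg ha zero_le_two)
    have h2 := card_exists_signed_indicator_le hE (fun i => (w i).2) (div_nonneg ha zero_le_two)
    have h0' := (Nat.cast_le (α := ℝ)).2 h0
    rw [Nat.cast_add] at h0'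
    rw [Fintype.card_fun, Fintype.card_bool, Nat.cast_pow, Nat.cast_ofNat]
    refine le_trans (le_of_eq ?_) (h0'.trans (b := _) (c := 2 ^ Fintype.card κ *
      (8 * Real.exp (-((a / 2) ^ 2) / (2 * Fintype.card κ)))) (by linarith))
    congr!

theorem measureReal_pi_exists_lt_le_of_fintype {ι : Type*} [LinearOrder ι] [Fintype ι]
    (η : Measure α) [IsProbabilityMeasure η] {E : ι → Set α} (hE : Monotone E)
    (hm : ∀ j, MeasurableSet (E j)) {a : ℝ} (ha : 0 < a) :
    (Measure.pi fun _ : κ => η).real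
      {x | ∃ j, a < |∑ i, (E j).indicator (fun _ => (1 : ℝ)) (x i) -
        Fintype.card κ * η.real (E j)|} ≤
      16 * Real.exp (-(a ^ 2) / (32 * Fintype.card κ)) := by
  -- Chebyshev at level `a / 2` gives probability at most `1 / 2` once `a² ≥ 2n`. For smaller `a`
  -- the right-hand side is at least `16 / e > 1`. The level is halved twice, whence `2 (a / 4)⁻² n
  -- = 32 n / a²`.
  rcases le_or_gt (2 * (Fintype.card κ : ℝ)) (a ^ 2) with hbig | hsmall
  · have hsym := measureReal_exists_lt_abs_le_two_mul_prod (P := Measure.pi fun _ : κ => η)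
      (D := fun j x => ∑ i, (E j).indicator (fun _ => (1 : ℝ)) (x i) -
        Fintype.card κ * η.real (E j))
      (fun j => (measurable_sum_indicator (hm j)).sub_const _) (a := a) (fun j => by
        refine (measureReal_pi_lt_abs_sum_indicator_le η (hm j) (half_pos ha)).trans ?_
        rw [div_le_div_iff₀ (by positivity) (by norm_num)]
        linarith)
    refine hsym.trans ?_
    have hgh := measureReal_pi_prod_exists_lt_le (κ := κ) η hE hm (half_pos ha).le
    have hmp := measurePreserving_arrowProdEquivProdArrow α α κ (fun _ => η) (fun _ => η)
    have heq : ((Measure.pi fun _ : κ => η).prod (Measure.pi fun _ : κ => η)).real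
        {p | ∃ j, a / 2 < |(∑ i, (E j).indicator (fun _ => (1 : ℝ)) (p.1 i) -
          Fintype.card κ * η.real (E j)) - (∑ i, (E j).indicator (fun _ => (1 : ℝ)) (p.2 i) -
          Fintype.card κ * η.real (E j))|} =
        (Measure.pi fun _ : κ => η.prod η).real
        {w | ∃ j, a / 2 < |∑ i, ((E j).indicator (fun _ => (1 : ℝ)) (w i).1 -
          (E j).indicator (fun _ => (1 : ℝ)) (w i).2)|} := by
      rw [measureReal_def, measureReal_def, ← hmp.map_eq, MeasurableEquiv.map_apply]
      congr 2
      ext w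
      simp [MeasurableEquiv.arrowProdEquivProdArrow, Equiv.arrowProdEquivProdArrow]
    rw [heq]
    have hexp : -((a / 2 / 2) ^ 2) / (2 * (Fintype.card κ : ℝ)) =
        -(a ^ 2) / (32 * Fintype.card κ) := by
      rcases eq_or_ne (Fintype.card κ : ℝ) 0 with h0 | h0
      · simp [h0]
      · field_simp; norm_num
    rw [hexp] at hgh
    linarith
  · refine measureReal_le_one.trans ?_
    have hpos : (0 : ℝ) < Fintype.card κ := by nlinarith [sq_nonneg a]
    have h1 : -1 ≤ -(a ^ 2) / (32 * (Fintype.card κ : ℝ)) := by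
      rw [le_div_iff₀ (by positivity)]
      linarith
    have h2 := Real.exp_le_exp.2 h1
    have h3 : (1 : ℝ) / 16 ≤ Real.exp (-1) := by
      rw [Real.exp_neg, ← one_div]
      exact one_div_le_one_div_of_le (Real.exp_pos _) (by linarith [Real.exp_one_lt_d9])
    linarith

open Classical in
/-- A Dvoretzky–Kiefer–Wolfowitz type inequality: a sub-Gaussian tail bound, without logarithmic
factor, for the deviations of empirical counts uniformly over a countable chain of sets. -/
theorem measure_pi_exists_lt_le {ι : Type*} [LinearOrder ι] [Countable ι]
    (η : Measure α) [IsProbabilityMeasure η] {E : ι → Set α} (hE : Monotone E)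
    (hm : ∀ j, MeasurableSet (E j)) {a : ℝ} (ha : 0 < a) :
    (Measure.pi fun _ : κ => η)
      {x | ∃ j, a < |((Finset.univ.filter fun i => x i ∈ E j).card : ℝ) -
        Fintype.card κ * η.real (E j)|} ≤
      ENNReal.ofReal (16 * Real.exp (-(a ^ 2) / (32 * Fintype.card κ))) := by
  have hcard : ∀ (x : κ → α) j, ((Finset.univ.filter fun i => x i ∈ E j).card : ℝ) =
      ∑ i, (E j).indicator (fun _ => (1 : ℝ)) (x i) := by
    intro x j
    have := sum_mul_indicator_eq (E j) x (fun _ => 1)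
    simpa using this.symm
  simp only [hcard]
  -- The finite bound does not depend on the size of the chain, so it passes to the directed union
  -- over finite subchains.
  have hU : {x : κ → α | ∃ j, a < |∑ i, (E j).indicator (fun _ => (1 : ℝ)) (x i) -
        Fintype.card κ * η.real (E j)|} =
      ⋃ F : Finset ι, {x : κ → α | ∃ j : F, a < |∑ i, (E j).indicator (fun _ => (1 : ℝ)) (x i) -
        Fintype.card κ * η.real (E j)|} := by
    ext x
    simp only [Set.mem_ofPred_eq, Set.mem_iUnion, Subtype.exists, exists_prop]
    exact ⟨fun ⟨j, hj⟩ => ⟨{j}, j, by simp, hj⟩, fun ⟨_, j, _, hj⟩ => ⟨j, hj⟩⟩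
  rw [hU, Directed.measure_iUnion]
  · refine iSup_le fun F => ?_
    rw [← ofReal_measureReal]
    exact ENNReal.ofReal_le_ofReal (measureReal_pi_exists_lt_le_of_fintype (ι := F) η
      (E := fun j => E j) (fun j k hjk => hE hjk) (fun j => hm j) ha)
  · refine Monotone.directed_le fun F F' h x => ?_
    rintro ⟨j, hj⟩
    exact ⟨⟨j, h j.2⟩, hj⟩

end Symmetrization

/-! ### First-order optimality and single crossing. -/

section Duality

open Filter Topology

variable {ι J : Type*} [Fintype ι]

-- Right derivative of a finite maximum. If all maximizers lie in `b`, a positive gap separates them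
-- from the rest, and for small `ε` the maximum drops by at least `ε (1 - l)`; otherwise the trivial
-- bound, a rise of at most `ε l`, suffices.
open Classical in
theorem eventually_iSup_sub_le [Nonempty ι] (α : ι → ℝ) (b : ι → Prop) (l : ℝ) :
    ∀ᶠ ε in 𝓝[>] (0 : ℝ), (⨆ k, (α k - ε * ((if b k then 1 else 0) - l))) ≤
      (⨆ k, α k) - ε * ((if ∃ k, b k ∧ ∀ k', ¬ b k' → α k' < α k then 1 else 0) - l) := by
  have hle : ∀ k, α k ≤ ⨆ k, α k := fun k => le_ciSup (Set.finite_range α).bddAbove k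
  split_ifs with h
  · obtain ⟨k₀, -, hk₀⟩ := h
    have hev : ∀ k', ∀ᶠ ε in 𝓝[>] (0 : ℝ), ¬ b k' → ε ≤ α k₀ - α k' := by
      intro k'
      by_cases hb : b k'
      · simp [hb]
      · have hpos : 0 < α k₀ - α k' := sub_pos.2 (hk₀ k' hb)
        filter_upwards [nhdsWithin_le_nhds (eventually_lt_nhds hpos)] with ε hε _
        exact hε.le
    filter_upwards [eventually_all.2 hev] with ε hε
    refine ciSup_le fun k => ?_
    split_ifs with hb
    · linarith [hle k]
    · linarith [hle k₀, hε k hb]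
  · filter_upwards [self_mem_nhdsWithin] with ε hε
    have hε' : 0 < ε := hε
    refine ciSup_le fun k => ?_
    split_ifs with hb
    · linarith [hle k]
    · linarith [hle k]

open Classical in
/-- First-order optimality, upper half: the number of indices at which the maximum is attained
only inside `b` is at most `l` times the total number. -/
theorem card_strict_le [Nonempty ι] (I : Finset J) (α : J → ι → ℝ) (b : ι → Prop) (l : ℝ)
    (hmin : ∀ ε : ℝ, ∑ i ∈ I, (⨆ k, α i k) ≤
      ∑ i ∈ I, ⨆ k, (α i k - ε * ((if b k then 1 else 0) - l))) :
    ((I.filter fun i => ∃ k, b k ∧ ∀ k', ¬ b k' → α i k' < α i k).card : ℝ) ≤ I.card * l := by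
  have hev : ∀ᶠ ε in 𝓝[>] (0 : ℝ), ∀ i ∈ I, (⨆ k, (α i k - ε * ((if b k then 1 else 0) - l))) ≤
      (⨆ k, α i k) - ε * ((if ∃ k, b k ∧ ∀ k', ¬ b k' → α i k' < α i k then 1 else 0) - l) :=
    (eventually_all_finset I).2 fun i _ => eventually_iSup_sub_le (α i) b l
  obtain ⟨ε, hε, hε0⟩ := (hev.and self_mem_nhdsWithin).exists
  have h := (hmin ε).trans (Finset.sum_le_sum hε)
  rw [Finset.sum_sub_distrib, ← Finset.mul_sum, Finset.sum_sub_distrib, Finset.sum_boole,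
    Finset.sum_const, nsmul_eq_mul] at h
  have hε0' : 0 < ε := hε0
  have : ε * (((I.filter fun i => ∃ k, b k ∧ ∀ k', ¬ b k' → α i k' < α i k).card : ℝ) -
      I.card * l) ≤ 0 := by linarith
  nlinarith

open Classical in
/-- First-order optimality, lower half: the number of indices at which the maximum is attained
inside `b` is at least `l` times the total number. -/
theorem le_card_weak [Nonempty ι] (I : Finset J) (α : J → ι → ℝ) (b : ι → Prop) (l : ℝ)
    (hmin : ∀ ε : ℝ, ∑ i ∈ I, (⨆ k, α i k) ≤
      ∑ i ∈ I, ⨆ k, (α i k - ε * ((if b k then 1 else 0) - l))) :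
    I.card * l ≤
      ((I.filter fun i => ∀ k, ¬ b k → ∃ k', b k' ∧ α i k ≤ α i k').card : ℝ) := by
  have h : ((I.filter fun i => ∃ k, ¬ b k ∧ ∀ k', ¬ ¬ b k' → α i k' < α i k).card : ℝ) ≤
      I.card * (1 - l) := by
    -- Moving in the direction `-ε` exchanges `b` with its complement and `l` with `1 - l`.
    convert card_strict_le I α (fun k => ¬ b k) (1 - l) (fun ε => by
      refine (hmin (-ε)).trans (le_of_eq ?_)
      refine Finset.sum_congr rfl fun i _ => iSup_congr fun k => ?_
      by_cases hb : b k <;> simp [hb]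
      ring)
  have hfilter : (I.filter fun i => ∀ k, ¬ b k → ∃ k', b k' ∧ α i k ≤ α i k') =
      I.filter fun i => ¬ ∃ k, ¬ b k ∧ ∀ k', ¬ ¬ b k' → α i k' < α i k := by
    refine Finset.filter_congr fun i _ => ?_
    push Not
    rfl
  have hsum := Finset.card_filter_add_card_filter_not (s := I)
    (fun i => ∃ k, ¬ b k ∧ ∀ k', ¬ ¬ b k' → α i k' < α i k)
  rw [hfilter]
  have hsum' : ((I.filter fun i => ∃ k, ¬ b k ∧ ∀ k', ¬ ¬ b k' → α i k' < α i k).card : ℝ) +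
      ((I.filter fun i => ¬ ∃ k, ¬ b k ∧ ∀ k', ¬ ¬ b k' → α i k' < α i k).card : ℝ) =
      I.card := by exact_mod_cast hsum
  linarith

/-- Single crossing: as `t` decreases, the maximizers of a penalized quadratic score decrease. -/
theorem exists_forall_lt_of_weak {y c : ι → ℝ} {w z t t' : ℝ} (hw : 0 < w) (htt' : t < t')
    (hne : ∃ k, y k ≤ z)
    (h : ∀ k, ¬ y k ≤ z → ∃ k', y k' ≤ z ∧
      -(w * (y k - t') ^ 2) - c k ≤ -(w * (y k' - t') ^ 2) - c k') :
    ∃ k, y k ≤ z ∧ ∀ k', ¬ y k' ≤ z →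
      -(w * (y k' - t) ^ 2) - c k' < -(w * (y k - t) ^ 2) - c k := by
  classical
  obtain ⟨k₁, hk₁⟩ := hne
  obtain ⟨k₀, hk₀, hmax⟩ := Finset.exists_max_image (Finset.univ.filter fun k => y k ≤ z)
    (fun k => -(w * (y k - t') ^ 2) - c k) ⟨k₁, by simpa using hk₁⟩
  have hk₀z : y k₀ ≤ z := by simpa using hk₀
  refine ⟨k₀, hk₀z, fun k hk => ?_⟩
  obtain ⟨k', hk'z, hk'⟩ := h k hk
  have h1 := hmax k' (by simpa using hk'z)
  have h2 : y k₀ < y k := lt_of_le_of_lt hk₀z (not_le.1 hk)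
  -- The terms in `t²` cancel: going from `t'` to `t`, the advantage of `k₀` over `k` grows by twice
  -- this quantity, which makes the weak inequality strict.
  have h3 : 0 < w * ((y k - y k₀) * (t' - t)) :=
    mul_pos hw (mul_pos (sub_pos.2 h2) (sub_pos.2 htt'))
  nlinarith

end Duality

/-! ### From empirical deviations to the constraint violation. -/

section Deterministic

variable {S : Type*} [Fintype S] [DecidableEq S] {d N M K : ℕ}

theorem thresholdVec_eq (z : Fin M → ℝ) (y : ℝ) (m : Fin M) [Decidable (y ≤ z m)] :
    thresholdVec z y m = if y ≤ z m then 1 else 0 := by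
  unfold thresholdVec
  congr

/-- The dual objective separates over groups: changing the multiplier at `(s, m)` alone leaves the
other groups unchanged, and the positive factor `1 / N_s` cancels. -/
theorem sum_iSup_empScore_le {A : ℝ} {f : Feat d → S → ℝ} {D : Fin N → Feat d × S}
    {ξ : Fin N → ℝ} {l z : Fin M → ℝ} {lam : S → Fin M → ℝ}
    (hmin : ∀ lam' : S → Fin M → ℝ, empDual A K f D ξ l z lam ≤ empDual A K f D ξ l z lam')
    {s : S} (hs : 0 < (groupIdx D s).card) (m : Fin M) (ε : ℝ) :
    ∑ i ∈ groupIdx D s, (⨆ k : Fin K,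
        empScore D l z lam s (dithered A f (D i).1 s (ξ i)) (gridPt A K k)) ≤
      ∑ i ∈ groupIdx D s, ⨆ k : Fin K,
        (empScore D l z lam s (dithered A f (D i).1 s (ξ i)) (gridPt A K k) -
          ε * (thresholdVec z (gridPt A K k) m - l m)) := by
  set lam' : S → Fin M → ℝ := Function.update lam s (Function.update (lam s) m (lam s m + ε))
    with hlam'
  have h := hmin lam'
  have hscore : ∀ t y, empScore D l z lam' s t y =
      empScore D l z lam s t y - ε * (thresholdVec z y m - l m) := by
    intro t y
    unfold empScore
    have : ∑ m', lam' s m' * (thresholdVec z y m' - l m') =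
        ∑ m', lam s m' * (thresholdVec z y m' - l m') + ε * (thresholdVec z y m - l m) := by
      rw [← Finset.add_sum_erase _ _ (Finset.mem_univ m),
        ← Finset.add_sum_erase _ (fun m' => lam s m' * (thresholdVec z y m' - l m'))
          (Finset.mem_univ m)]
      have h1 : ∑ m' ∈ Finset.univ.erase m, lam' s m' * (thresholdVec z y m' - l m') =
          ∑ m' ∈ Finset.univ.erase m, lam s m' * (thresholdVec z y m' - l m') := by
        refine Finset.sum_congr rfl fun m' hm' => ?_
        simp [hlam', Function.update_of_ne (Finset.ne_of_mem_erase hm')]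
      rw [h1]
      simp only [hlam', Function.update_self]
      ring
    rw [this]
    ring
  have hother : ∀ s' ≠ s, ∀ t y, empScore D l z lam' s' t y = empScore D l z lam s' t y := by
    intro s' hs' t y
    simp [empScore, hlam', Function.update_of_ne hs']
  unfold empDual at h
  rw [← Finset.add_sum_erase _ _ (Finset.mem_univ s),
    ← Finset.add_sum_erase Finset.univ (fun s => 1 / ((groupIdx D s).card : ℝ) *
    ∑ i ∈ groupIdx D s, ⨆ k : Fin K,
      empScore D l z lam' s (dithered A f (D i).1 s (ξ i)) (gridPt A K k))
      (Finset.mem_univ s)] at h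
  have hrest : ∑ s' ∈ Finset.univ.erase s, 1 / ((groupIdx D s').card : ℝ) *
      ∑ i ∈ groupIdx D s', (⨆ k : Fin K,
        empScore D l z lam' s' (dithered A f (D i).1 s' (ξ i)) (gridPt A K k)) =
      ∑ s' ∈ Finset.univ.erase s, 1 / ((groupIdx D s').card : ℝ) *
      ∑ i ∈ groupIdx D s', (⨆ k : Fin K,
        empScore D l z lam s' (dithered A f (D i).1 s' (ξ i)) (gridPt A K k)) :=
    Finset.sum_congr rfl fun s' hs' => by
      simp only [hother s' (Finset.ne_of_mem_erase hs')]
  rw [hrest] at h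
  have h' := le_of_add_le_add_right h
  have hpos : 0 < 1 / ((groupIdx D s).card : ℝ) := one_div_pos.2 (Nat.cast_pos.2 hs)
  have h'' := le_of_mul_le_mul_left h' hpos
  simpa only [hscore] using h''

/-- Bounds on a continuous function at the rationals on both sides of `τ` carry over to any value
squeezed between its left limit and its value at `τ`. -/
theorem bounds_of_forall_rat {F : ℝ → ℝ} (hF : Continuous F) {p τ c₁ c₂ : ℝ}
    (h1 : ∀ t < τ, F t ≤ p) (h2 : p ≤ F τ) (h3 : ∀ q : ℚ, (q : ℝ) < τ → F q ≤ c₁)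
    (h4 : ∀ q : ℚ, τ < (q : ℝ) → c₂ ≤ F q) : c₂ ≤ p ∧ p ≤ c₁ := by
  have hle : ∀ c, (∀ q : ℚ, (q : ℝ) < τ → F q ≤ c) → F τ ≤ c := by
    intro c hc
    by_contra! hcon
    obtain ⟨r, hr, hsub⟩ := Metric.isOpen_iff.1 (isOpen_lt continuous_const hF) τ hcon
    obtain ⟨q, hq1, hq2⟩ := exists_rat_btwn (sub_lt_self τ hr)
    have hq : (q : ℝ) ∈ Metric.ball τ r := by
      rw [Real.ball_eq_Ioo]; exact ⟨hq1, by linarith⟩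
    exact absurd (hc q hq2) (not_le.2 (hsub hq))
  have hge : c₂ ≤ F τ := by
    by_contra! hcon
    obtain ⟨r, hr, hsub⟩ := Metric.isOpen_iff.1 (isOpen_lt hF continuous_const) τ hcon
    obtain ⟨q, hq1, hq2⟩ := exists_rat_btwn (lt_add_of_pos_right τ hr)
    have hq : (q : ℝ) ∈ Metric.ball τ r := by
      rw [Real.ball_eq_Ioo]; exact ⟨by linarith, hq2⟩
    exact absurd (h4 q hq1) (not_le.2 (hsub hq))
  exact ⟨hge.trans (hle p fun q hq => h1 q hq), h2.trans (hle c₁ h3)⟩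

open Classical in
/-- If the empirical counts of the half-lines `{f̄ ≤ q}` in group `s` deviate by at most `a` from
their means, then a post-processed predictor violates the constraints of group `s` by at most
`2 a / (N π)`. -/
theorem abs_measureReal_sub_le {A : ℝ} {f : Feat d → S → ℝ} {D : Fin N → Feat d × S}
    {ξ : Fin N → ℝ} {l z : Fin M → ℝ} {g : Feat d → S → ℝ → ℝ} (hN : 1 ≤ N) (hK : 2 ≤ K)
    (hl : ∀ m, l m ∈ Set.Ioo (0 : ℝ) 1) (hz : ∀ m, z m ∈ Set.Icc (-A) A)
    (hg : IsPostProcessed A K f D ξ l z g) (s : S) (m : Fin M)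
    (Q : Measure (Feat d × ℝ)) [IsProbabilityMeasure Q]
    (hF : Continuous fun t : ℝ => Q.real {p | dithered A f p.1 s p.2 ≤ t})
    {π a : ℝ} (hπ : 0 < π)
    (hdev : ∀ q : ℚ, |((Finset.univ.filter fun i => (D i).2 = s ∧
      dithered A f (D i).1 s (ξ i) ≤ q).card : ℝ) -
        N * (π * Q.real {p | dithered A f p.1 s p.2 ≤ q})| ≤ a)
    (hgrp : |((groupIdx D s).card : ℝ) - N * π| ≤ a) :
    N * π * |Q.real {p | g p.1 s p.2 ≤ z m} - l m| ≤ 2 * a := by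
  obtain ⟨lam, hmin, hgm, hgsel⟩ := hg
  have hN0 : (0 : ℝ) < N := Nat.cast_pos.2 hN
  have hNπ : 0 < N * π := mul_pos hN0 hπ
  obtain ⟨hl0, hl1⟩ := hl m
  set p := Q.real {p | g p.1 s p.2 ≤ z m} with hp
  have hp0 : 0 ≤ p := measureReal_nonneg
  have hp1 : p ≤ 1 := measureReal_le_one
  have ha : 0 ≤ a := (abs_nonneg _).trans hgrp
  rw [abs_le] at hgrp
  -- In an empty group optimality says nothing, but then `N π ≤ a` and the violation is at most `1`.
  rcases Nat.eq_zero_or_pos (groupIdx D s).card with h0 | hpos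
  · have habs : |p - l m| ≤ 1 := abs_le.2 ⟨by linarith, by linarith⟩
    rw [h0, Nat.cast_zero] at hgrp
    nlinarith [hgrp.1]
  have hn0 : (0 : ℝ) < (groupIdx D s).card := Nat.cast_pos.2 hpos
  have : Nonempty (Fin K) := ⟨⟨0, by omega⟩⟩
  set w := empWeight D s with hw
  have hw0 : 0 < w := div_pos hn0 hN0
  set c : Fin K → ℝ := fun k => ∑ m', lam s m' * (thresholdVec z (gridPt A K k) m' - l m')
  -- `St t`: every maximizer at `t` is at most `z m`. `W t`: some maximizer is. A prediction at most
  -- `z m` is forced by `St` and implies `W`.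
  set St : ℝ → Prop := fun t => ∃ k, gridPt A K k ≤ z m ∧ ∀ k', ¬ gridPt A K k' ≤ z m →
    -(w * (gridPt A K k' - t) ^ 2) - c k' < -(w * (gridPt A K k - t) ^ 2) - c k with hSt
  set W : ℝ → Prop := fun t => ∀ k, ¬ gridPt A K k ≤ z m → ∃ k', gridPt A K k' ≤ z m ∧
    -(w * (gridPt A K k - t) ^ 2) - c k ≤ -(w * (gridPt A K k' - t) ^ 2) - c k' with hW
  have hmin' := fun ε => sum_iSup_empScore_le hmin hpos m ε
  have hne : ∃ k, gridPt A K k ≤ z m :=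
    ⟨⟨0, by omega⟩, by simpa [gridPt] using (hz m).1⟩
  simp only [thresholdVec_eq z _ m] at hmin'
  have hStcard : (((groupIdx D s).filter fun i => St (dithered A f (D i).1 s (ξ i))).card : ℝ) ≤
      (groupIdx D s).card * l m := by
    convert card_strict_le (groupIdx D s) (fun i k =>
      empScore D l z lam s (dithered A f (D i).1 s (ξ i)) (gridPt A K k))
      (fun k => gridPt A K k ≤ z m) (l m) hmin' <;> rfl
  have hWcard : (groupIdx D s).card * l m ≤
      (((groupIdx D s).filter fun i => W (dithered A f (D i).1 s (ξ i))).card : ℝ) := by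
    convert le_card_weak (groupIdx D s) (fun i k =>
      empScore D l z lam s (dithered A f (D i).1 s (ξ i)) (gridPt A K k))
      (fun k => gridPt A K k ≤ z m) (l m) hmin' <;> rfl
  have hcross : ∀ t t', t < t' → W t' → St t := fun t t' htt' h =>
    exists_forall_lt_of_weak hw0 htt' hne h
  have hgcost : ∀ x t, ∃ k, g x s t = gridPt A K k ∧ ∀ k',
      -(w * (gridPt A K k' - dithered A f x s t) ^ 2) - c k' ≤
        -(w * (gridPt A K k - dithered A f x s t) ^ 2) - c k := by
    intro x t
    obtain ⟨⟨k, hk⟩, hopt⟩ := hgsel x s t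
    refine ⟨k, hk.symm, fun k' => ?_⟩
    have h1 := hopt k'
    rw [← hk] at h1
    simp only [c, mul_sub, Finset.sum_sub_distrib]
    linarith
  have hgSt : ∀ x t, St (dithered A f x s t) → g x s t ≤ z m := by
    intro x t ⟨k₀, _, hk₀⟩
    obtain ⟨k, hk, hopt⟩ := hgcost x t
    rw [hk]
    by_contra hcon
    exact absurd (hk₀ k hcon) (not_lt.2 (hopt k₀))
  have hgW : ∀ x t, g x s t ≤ z m → W (dithered A f x s t) := by
    intro x t hgt k' _
    obtain ⟨k, hk, hopt⟩ := hgcost x t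
    exact ⟨k, hk ▸ hgt, hopt k'⟩
  -- Here `0 < ℓ_m` rules out that `W` is empty; next, `ℓ_m < 1` rules out that it is everything.
  -- Hence the cutoff is finite.
  have hWne : ∃ t, W t := by
    by_contra! hcon
    simp only [hcon, Finset.filter_false, Finset.card_empty, Nat.cast_zero] at hWcard
    nlinarith
  have hWbdd : ∃ t, ¬ W t := by
    by_contra! hcon
    have hall : ∀ t, St t := fun t => hcross t (t + 1) (by linarith) (hcon _)
    simp only [hall, Finset.filter_true] at hStcard
    nlinarith
  obtain ⟨t₀, ht₀⟩ := hWne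
  obtain ⟨t₁, ht₁⟩ := hWbdd
  have hStW : ∀ t, St t → W t := by
    rintro t ⟨k, hk, hlt⟩ k' hk'
    exact ⟨k, hk, (hlt k' hk').le⟩
  have hub : t₁ ∈ upperBounds {t | W t} := by
    intro t ht
    by_contra! hcon
    exact ht₁ (hStW _ (hcross t₁ t hcon ht))
  set τ := sSup {t | W t}
  have hlt : ∀ t < τ, St t := by
    intro t ht
    obtain ⟨t', ht', htt'⟩ := exists_lt_of_lt_csSup
      (⟨t₀, ht₀⟩ : {t | W t}.Nonempty) ht
    exact hcross t t' htt' ht'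
  have hle : ∀ t, W t → t ≤ τ := fun t ht => le_csSup ⟨t₁, hub⟩ ht
  have hcount₁ : ∀ q : ℚ, (q : ℝ) < τ →
      Q.real {p | dithered A f p.1 s p.2 ≤ q} ≤ l m + 2 * a / (N * π) := by
    intro q hq
    have hsub : (Finset.univ.filter fun i => (D i).2 = s ∧ dithered A f (D i).1 s (ξ i) ≤ q) ⊆
        (groupIdx D s).filter fun i => St (dithered A f (D i).1 s (ξ i)) := by
      intro i hi
      obtain ⟨h1, h2⟩ := (Finset.mem_filter.1 hi).2
      exact Finset.mem_filter.2 ⟨Finset.mem_filter.2 ⟨Finset.mem_univ _, h1⟩,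
        hlt _ (lt_of_le_of_lt h2 hq)⟩
    have h1 := (Nat.cast_le (α := ℝ)).2 (Finset.card_le_card hsub)
    have h2 := (abs_le.1 (hdev q)).1
    -- One `a` comes from the group size, using `ℓ_m ≤ 1`, and the other from the count: together `2
    -- a`.
    have h3 : (groupIdx D s).card * l m ≤ N * π * l m + a := by nlinarith [hgrp.2]
    rw [← sub_le_iff_le_add', le_div_iff₀ hNπ]
    nlinarith
  have hcount₂ : ∀ q : ℚ, τ < (q : ℝ) →
      l m - 2 * a / (N * π) ≤ Q.real {p | dithered A f p.1 s p.2 ≤ q} := by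
    intro q hq
    have hsub : ((groupIdx D s).filter fun i => W (dithered A f (D i).1 s (ξ i))) ⊆
        Finset.univ.filter fun i => (D i).2 = s ∧ dithered A f (D i).1 s (ξ i) ≤ q := by
      intro i hi
      obtain ⟨h1, h2⟩ := Finset.mem_filter.1 hi
      exact Finset.mem_filter.2 ⟨Finset.mem_univ _, (Finset.mem_filter.1 h1).2,
        ((hle _ h2).trans_lt hq).le⟩
    have h1 := (Nat.cast_le (α := ℝ)).2 (Finset.card_le_card hsub)
    have h2 := (abs_le.1 (hdev q)).2
    have h3 : N * π * l m - a ≤ (groupIdx D s).card * l m := by nlinarith [hgrp.1]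
    rw [sub_le_comm, le_div_iff₀ hNπ]
    nlinarith
  -- The event `g ≤ z m` lies between `{f̄ < τ}` and `{f̄ ≤ τ}`, which continuity of `F` makes
  -- equally likely.
  have hb := bounds_of_forall_rat hF (p := p) (τ := τ)
    (fun t ht => measureReal_mono fun x hx => hgSt _ _ (hlt _ (lt_of_le_of_lt hx ht)))
    (measureReal_mono fun x hx => hle _ (hgW _ _ hx)) hcount₁ hcount₂
  have hfin : |p - l m| ≤ 2 * a / (N * π) := abs_le.2 ⟨by linarith [hb.1], by linarith [hb.2]⟩
  rw [le_div_iff₀ hNπ] at hfin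
  linarith

end Deterministic

/-! ### Continuity of the dithered law and disintegration over groups. -/

section Laws

theorem continuous_measureReal_Iic_of_measure_singleton (ν : Measure ℝ) [IsProbabilityMeasure ν]
    (h : ∀ t, ν {t} = 0) : Continuous fun t : ℝ => ν.real (Set.Iic t) := by
  have heq : (fun t : ℝ => ν.real (Set.Iic t)) = cdf ν := funext fun t => (cdf_eq_real ν t).symm
  rw [heq, continuous_iff_continuousAt]
  intro t
  have h1 := (cdf ν).measure_singleton t
  rw [measure_cdf, h t] at h1
  have h2 : cdf ν t ≤ Function.leftLim (cdf ν) t := by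
    have := ENNReal.ofReal_eq_zero.1 h1.symm
    linarith
  rw [(cdf ν).mono.continuousAt_iff_leftLim_eq_rightLim, (cdf ν).rightLim_eq]
  exact le_antisymm ((cdf ν).mono.leftLim_le le_rfl) h2

theorem ditherLaw_zero : ditherLaw 0 = Measure.dirac 0 := by
  simp [ditherLaw, Measure.map_const]

theorem ditherLaw_singleton {u : ℝ} (hu : u ≠ 0) (t : ℝ) : ditherLaw u {t} = 0 := by
  rw [ditherLaw, Measure.map_apply (by fun_prop) (measurableSet_singleton t)]
  have : (fun v => u * v) ⁻¹' {t} = {t / u} := by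
    ext v
    simp [eq_div_iff hu, mul_comm]
  rw [this]
  exact measure_singleton _

variable {Ω S : Type*} [MeasurableSpace Ω]
  {d : ℕ} {μ : Measure Ω} [IsProbabilityMeasure μ] {X : Ω → Feat d} {G : Ω → S}

theorem isProbabilityMeasure_groupLaw (hX : Measurable X) (u : ℝ) {s : S}
    (hs : 0 < groupProb μ G s) : IsProbabilityMeasure (groupLaw μ X G u s) := by
  have h0 : μ (G ⁻¹' {s}) ≠ 0 := fun h => by simp [groupProb, measureReal_def, h] at hs
  have := cond_isProbabilityMeasure h0
  have := Measure.isProbabilityMeasure_map (μ := cond μ (G ⁻¹' {s})) hX.aemeasurable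
  unfold groupLaw
  infer_instance

theorem measurable_dithered {A : ℝ} {f : Feat d → S → ℝ} {s : S} (hf : Measurable fun x => f x s) :
    Measurable fun p : Feat d × ℝ => dithered A f p.1 s p.2 :=
  measurable_const.max (measurable_const.min ((hf.comp measurable_fst).add measurable_snd))

/-- Almost surely the projection does nothing. With `u ≠ 0`, an independent atomless dither leaves
no atom in the sum; with `u = 0`, continuity is assumed. -/
theorem continuous_measureReal_dithered (hX : Measurable X) {A u : ℝ} {f : Feat d → S → ℝ}
    {s : S} (hf : Measurable fun x => f x s) (hs : 0 < groupProb μ G s)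
    (hreg : DitherRegular μ X G A u f) :
    Continuous fun t : ℝ => (groupLaw μ X G u s).real {p | dithered A f p.1 s p.2 ≤ t} := by
  have hprob := isProbabilityMeasure_groupLaw (G := G) (μ := μ) hX u hs
  have hproj : ∀ᵐ p ∂(groupLaw μ X G u s), dithered A f p.1 s p.2 = f p.1 s + p.2 := by
    filter_upwards [hreg.1 s] with p hp
    rw [dithered, min_eq_right hp.2.le, max_eq_right hp.1.le]
  rcases eq_or_ne u 0 with hu | hu
  · convert hreg.2 hu s using 2 with t
    have hzero : ∀ᵐ p ∂(groupLaw μ X G u s), p.2 = 0 := by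
      have h0 : ∀ᵐ y ∂(ditherLaw u), y = 0 := by
        rw [hu, ditherLaw_zero]
        exact (ae_dirac_iff (measurableSet_singleton 0)).2 rfl
      exact Measure.quasiMeasurePreserving_snd.ae h0
    refine measureReal_congr ?_
    filter_upwards [hproj, hzero] with p hp hp0
    change (dithered A f p.1 s p.2 ≤ t) = (f p.1 s ≤ t)
    rw [hp, hp0, add_zero]
  · have hm : Measurable fun p : Feat d × ℝ => f p.1 s + p.2 :=
      (hf.comp measurable_fst).add measurable_snd
    set ν := (groupLaw μ X G u s).map fun p => f p.1 s + p.2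
    have hν : IsProbabilityMeasure ν := Measure.isProbabilityMeasure_map hm.aemeasurable
    have hcont := continuous_measureReal_Iic_of_measure_singleton ν fun t => by
      rw [Measure.map_apply hm (measurableSet_singleton t)]
      refine (Measure.measure_prod_null (hm (measurableSet_singleton t))).2
        (Filter.Eventually.of_forall fun x => ?_)
      refine measure_mono_null (t := {t - f x s}) (fun y hy => ?_) (ditherLaw_singleton hu _)
      have hy' : f x s + y = t := hy
      exact Set.mem_singleton_iff.2 (by linarith)
    convert hcont using 2 with t
    rw [map_measureReal_apply hm measurableSet_Iic]
    refine measureReal_congr ?_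
    filter_upwards [hproj] with p hp
    change (dithered A f p.1 s p.2 ≤ t) = (f p.1 s + p.2 ≤ t)
    rw [hp]

theorem measureReal_prod_ditherLaw_eq [MeasurableSpace S] [DiscreteMeasurableSpace S]
    (hX : Measurable X) (hG : Measurable G) (u : ℝ)
    (s : S) {B : Set (Feat d × ℝ)} (hB : MeasurableSet B) :
    ((μ.map fun ω => (X ω, G ω)).prod (ditherLaw u)).real {w | w.1.2 = s ∧ (w.1.1, w.2) ∈ B} =
      groupProb μ G s * (groupLaw μ X G u s).real B := by
  have hXG : Measurable fun ω => (X ω, G ω) := hX.prodMk hG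
  have := Measure.isProbabilityMeasure_map (μ := μ) hXG.aemeasurable
  have hGs : MeasurableSet (G ⁻¹' {s}) := hG (MeasurableSet.of_discrete)
  have hset : MeasurableSet {w : (Feat d × S) × ℝ | w.1.2 = s ∧ (w.1.1, w.2) ∈ B} := by
    refine MeasurableSet.inter ?_ ?_
    · exact (measurable_snd.comp measurable_fst) (MeasurableSet.of_discrete (s := {s}))
    · exact ((measurable_fst.comp measurable_fst).prodMk measurable_snd) hB
  rw [groupProb, measureReal_def, measureReal_def, measureReal_def, ← ENNReal.toReal_mul]
  congr 1
  rw [groupLaw, Measure.prod_apply_symm hset, Measure.prod_apply_symm hB,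
    ← lintegral_const_mul _ (measurable_measure_prodMk_right hB)]
  refine lintegral_congr fun y => ?_
  have hBy : MeasurableSet ((fun x => (x, y)) ⁻¹' B) := measurable_prodMk_right hB
  rw [Measure.map_apply hXG (measurable_prodMk_right hset), Measure.map_apply hX hBy,
    mul_comm, cond_mul_eq_inter hGs]
  rfl

end Laws

/-! ### Uniform concentration within a group, and conditioning on the labeled sample. -/

section Concentration

variable {Ω S : Type*} [MeasurableSpace Ω] [DecidableEq S] [MeasurableSpace S]
  [DiscreteMeasurableSpace S] {d N : ℕ} {μ : Measure Ω} [IsProbabilityMeasure μ]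
  {X : Ω → Feat d} {G : Ω → S}

open Classical in
/-- Uniform concentration, in group `s`, of the empirical counts of the half-lines
`{f̄ ≤ q}` and of the size of the group. -/
theorem measure_groupDeviation_le (hX : Measurable X) (hG : Measurable G) (A u : ℝ)
    {f : Feat d → S → ℝ} (s : S) (hf : Measurable fun x => f x s) {a : ℝ} (ha : 0 < a) :
    ((Measure.pi fun _ : Fin N => μ.map fun ω => (X ω, G ω)).prod
      (Measure.pi fun _ : Fin N => ditherLaw u))
      {w | ¬ ((∀ q : ℚ, |((Finset.univ.filter fun i => (w.1 i).2 = s ∧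
          dithered A f (w.1 i).1 s (w.2 i) ≤ q).card : ℝ) -
          N * (groupProb μ G s *
            (groupLaw μ X G u s).real {p | dithered A f p.1 s p.2 ≤ q})| ≤ a) ∧
        |((groupIdx w.1 s).card : ℝ) - N * groupProb μ G s| ≤ a)} ≤
      ENNReal.ofReal (16 * Real.exp (-(a ^ 2) / (32 * N))) := by
  have hXG : Measurable fun ω => (X ω, G ω) := hX.prodMk hG
  have := Measure.isProbabilityMeasure_map (μ := μ) hXG.aemeasurable
  set η := (μ.map fun ω => (X ω, G ω)).prod (ditherLaw u)
  -- The extra index `⊤` gives the whole space, so the group size joins the same chain and costs no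
  -- further union bound. Intersecting with `S = s`, rather than conditioning, keeps the number of
  -- draws equal to `N`.
  let B : WithTop ℚ → Set (Feat d × ℝ) := fun j =>
    {p | ∀ q : ℚ, j ≤ (q : WithTop ℚ) → dithered A f p.1 s p.2 ≤ q}
  let E : WithTop ℚ → Set ((Feat d × S) × ℝ) := fun j => {w | w.1.2 = s ∧ (w.1.1, w.2) ∈ B j}
  have hBq : ∀ q : ℚ, B q = {p | dithered A f p.1 s p.2 ≤ q} := by
    intro q
    ext p
    refine ⟨fun h => h q le_rfl, fun h q' hq' => le_trans (b := (q : ℝ)) h ?_⟩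
    exact_mod_cast WithTop.coe_le_coe.1 hq'
  have hBtop : B ⊤ = Set.univ := by
    ext p
    simp [B]
  have hBm : ∀ j, MeasurableSet (B j) := by
    intro j
    induction j using WithTop.recTopCoe with
    | top => rw [hBtop]; exact MeasurableSet.univ
    | coe q => rw [hBq]; exact measurableSet_le (measurable_dithered hf) measurable_const
  have hEm : ∀ j, MeasurableSet (E j) := by
    intro j
    refine MeasurableSet.inter ?_ ?_
    · exact (measurable_snd.comp measurable_fst) (MeasurableSet.of_discrete (s := {s}))
    · exact ((measurable_fst.comp measurable_fst).prodMk measurable_snd) (hBm j)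
  have hEmono : Monotone E := fun j k hjk w hw => ⟨hw.1, fun q hq => hw.2 q (hjk.trans hq)⟩
  have hη : ∀ j, η.real (E j) = groupProb μ G s * (groupLaw μ X G u s).real (B j) := fun j =>
    measureReal_prod_ditherLaw_eq hX hG u s (hBm j)
  have hηtop : η.real (E ⊤) = groupProb μ G s := by
    rw [hη, hBtop]
    rcases (measureReal_nonneg : 0 ≤ μ.real (G ⁻¹' {s})).eq_or_lt with h0 | h0
    · rw [groupProb, ← h0, zero_mul]
    · have := isProbabilityMeasure_groupLaw (G := G) (μ := μ) hX u (s := s) h0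
      rw [probReal_univ, mul_one]
  have hmain := measure_pi_exists_lt_le (κ := Fin N) η hEmono hEm ha
  rw [Fintype.card_fin] at hmain
  have hmp := measurePreserving_arrowProdEquivProdArrow (Feat d × S) ℝ (Fin N)
    (fun _ => μ.map fun ω => (X ω, G ω)) (fun _ => ditherLaw u)
  rw [← hmp.map_eq, MeasurableEquiv.map_apply]
  refine (measure_mono fun w hw => ?_).trans hmain
  have hw' := not_and_or.1 hw
  rcases hw' with hw' | hw'
  · push Not at hw'
    obtain ⟨q, hq⟩ := hw'
    refine ⟨q, ?_⟩
    rw [hη, hBq]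
    refine lt_of_lt_of_eq hq ?_
    simp only [E, hBq]
    rfl
  · refine ⟨⊤, ?_⟩
    rw [hηtop]
    refine lt_of_lt_of_eq (not_le.1 hw') ?_
    simp only [E, hBtop, Set.mem_univ, and_true, groupIdx]
    congr!

theorem condDistrib_ae_eq_const {β γ : Type*} [MeasurableSpace β] [MeasurableSpace γ]
    [StandardBorelSpace γ] [Nonempty γ] {V : Ω → β} {W : Ω → γ} (hV : AEMeasurable V μ)
    (hW : AEMeasurable W μ) (h : IndepFun V W μ) :
    condDistrib W V μ =ᵐ[μ.map V] Kernel.const β (μ.map W) := by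
  have := Measure.isProbabilityMeasure_map (μ := μ) hW
  have := Measure.isProbabilityMeasure_map (μ := μ) hV
  refine condDistrib_ae_eq_of_measure_eq_compProd V hW ?_
  rw [Measure.compProd_const]
  exact (indepFun_iff_map_prod_eq_prod_map_map hV hW).1 h

/-- Splits `log (c / δ)` as `log c + log (1 / δ)` and uses subadditivity of the square root, so that
`c` enters only the constant. -/
theorem two_mul_div_le {n : ℝ} (hn : 0 < n) {c δ πmin : ℝ} (hc : 1 ≤ c) (hδ : 0 < δ) (hδ1 : δ < 1)
    (hπ : 0 < πmin) :
    2 * √(32 * n * Real.log (c / δ)) / (n * πmin) ≤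
      2 * √32 * (√(Real.log c) + 1) / πmin * (√(1 / n) + √(Real.log (1 / δ) / n)) := by
  have hlogc : 0 ≤ Real.log c := Real.log_nonneg hc
  have hlogd : 0 ≤ Real.log (1 / δ) := Real.log_nonneg (by rw [le_div_iff₀ hδ]; linarith)
  have hlog : Real.log (c / δ) = Real.log c + Real.log (1 / δ) := by
    rw [← Real.log_mul (by positivity) (by positivity), mul_one_div]
  have h1 : √(32 * n * Real.log (c / δ)) = √32 * n * √(Real.log (c / δ) / n) := by
    rw [show 32 * n * Real.log (c / δ) = 32 * (n ^ 2 * (Real.log (c / δ) / n)) by field_simp,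
      Real.sqrt_mul (by norm_num), Real.sqrt_mul (sq_nonneg n), Real.sqrt_sq hn.le, mul_assoc]
  have h2 : √(Real.log (c / δ) / n) ≤ √(Real.log c) * √(1 / n) + √(Real.log (1 / δ) / n) := by
    rw [← Real.sqrt_mul hlogc, mul_one_div, hlog, add_div]
    refine Real.sqrt_le_iff.2 ⟨by positivity, ?_⟩
    have hx : 0 ≤ Real.log c / n := by positivity
    have hy : 0 ≤ Real.log (1 / δ) / n := by positivity
    have := mul_nonneg (Real.sqrt_nonneg (Real.log c / n)) (Real.sqrt_nonneg (Real.log (1 / δ) / n))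
    nlinarith [Real.sq_sqrt hx, Real.sq_sqrt hy]
  rw [h1, show 2 * (√32 * n * √(Real.log (c / δ) / n)) / (n * πmin) =
    2 * √32 / πmin * √(Real.log (c / δ) / n) by field_simp,
    show 2 * √32 * (√(Real.log c) + 1) / πmin * (√(1 / n) + √(Real.log (1 / δ) / n)) =
    2 * √32 / πmin * ((√(Real.log c) + 1) * (√(1 / n) + √(Real.log (1 / δ) / n))) by ring]
  refine mul_le_mul_of_nonneg_left (h2.trans ?_) (by positivity)
  have h3 : 0 ≤ √(Real.log c) * √(Real.log (1 / δ) / n) := by positivity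
  have h4 : 0 ≤ √(1 / n) := by positivity
  nlinarith

end Concentration

end FairPost

/-! ### Union bound over the groups. -/

theorem mainTheorem5 {S : Type*} [Fintype S] [DecidableEq S] [Nonempty S] [MeasurableSpace S]
    [DiscreteMeasurableSpace S] (πmin : ℝ) (hπmin : 0 < πmin) :
    ∃ C : ℝ, 0 < C ∧
      ∀ {Ω : Type*} [MeasurableSpace Ω] (μ : Measure Ω) [IsProbabilityMeasure μ]
        -- the population triplet `(X, G, Y)`, with `|Y| ≤ A` and `min_s π_s = πmin`
        (d : ℕ) (X : Ω → FairPost.Feat d) (G : Ω → S) (Y : Ω → ℝ)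
        (_hX : Measurable X) (_hG : Measurable G) (_hY : Measurable Y)
        (A : ℝ) (_hA : 0 < A) (_hYA : ∀ᵐ ω ∂μ, |Y ω| ≤ A)
        (_hmin : IsLeast (Set.range (FairPost.groupProb μ G)) πmin)
        -- grid size, levels and thresholds
        (K : ℕ) (_hK : 2 ≤ K) (M : ℕ) (_hM : 1 ≤ M) (l z : Fin M → ℝ)
        (_hl : StrictMono l) (_hl01 : ∀ m, l m ∈ Set.Ioo (0 : ℝ) 1)
        (_hz : StrictMono z) (_hzA : ∀ m, z m ∈ Set.Icc (-A) A)
        -- labeled sample `L`, unlabeled sample `U`, and dither `ξ` of the unlabeled sample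
        (n N : ℕ) (_hN : 1 ≤ N) (u : ℝ) (_hu : 0 ≤ u)
        (L : Fin n → Ω → FairPost.Feat d × S × ℝ)
        (U : Fin N → Ω → FairPost.Feat d × S)
        (ξ : Fin N → Ω → ℝ)
        (_hL : ∀ i, IdentDistrib (L i) (fun ω => (X ω, G ω, Y ω)) μ μ)
        (_hU : ∀ j, IdentDistrib (U j) (fun ω => (X ω, G ω)) μ μ)
        (_hξ : ∀ j, HasLaw (ξ j) (FairPost.ditherLaw u) μ)
        (_hLi : iIndepFun L μ) (_hUi : iIndepFun U μ) (_hξi : iIndepFun ξ μ)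
        (_hUξ : IndepFun (fun ω j => U j ω) (fun ω j => ξ j ω) μ)
        (_hLUξ : IndepFun (fun ω i => L i ω) (fun ω => ((fun j => U j ω), (fun j => ξ j ω))) μ)
        -- the base regressor, an arbitrary function of the labeled sample
        (fhat : (Fin n → FairPost.Feat d × S × ℝ) → FairPost.Feat d → S → ℝ)
        (_hfhat : ∀ D s, Measurable fun x => fhat D x s)
        (δ : ℝ) (_hδ : δ ∈ Set.Ioo (0 : ℝ) 1),
        -- conditionally on the labeled sample `D`, the probability that the bound fails for some
        -- post-processed predictor is at most `δ`
        ∀ᵐ D ∂(μ.map fun ω i => L i ω),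
          FairPost.DitherRegular μ X G A u (fhat D) →
          condDistrib (fun ω => ((fun j => U j ω), (fun j => ξ j ω))) (fun ω i => L i ω) μ D
            {w | ¬ ∀ g : FairPost.Feat d → S → ℝ → ℝ,
              FairPost.IsPostProcessed A K (fhat D) w.1 w.2 l z g →
                FairPost.violation μ X G u l z g ≤
                  C * (√(1 / N) + (K : ℝ) ^ 2 / N + √(Real.log (1 / δ) / N))}
            ≤ ENNReal.ofReal δ := by
  classical
  set c : ℝ := 16 * Fintype.card S with hc
  have hcard : (1 : ℝ) ≤ Fintype.card S := Nat.one_le_cast.2 Fintype.card_pos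
  have hc16 : 16 ≤ c := by linarith
  refine ⟨2 * √32 * (√(Real.log c) + 1) / πmin, by positivity, ?_⟩
  intro Ω _ μ _ d X G Y hX hG _ A _ _ hmin K hK M hM l z _ hl01 _ hzA n N hN u _ L U ξ hL hU hξ
    _ hUi hξi hUξ hLUξ fhat hfhat δ hδ
  have hN0 : (0 : ℝ) < N := Nat.cast_pos.2 hN
  have hLm : AEMeasurable (fun ω i => L i ω) μ :=
    aemeasurable_pi_lambda _ fun i => (hL i).aemeasurable_fst
  have hUm : ∀ j, AEMeasurable (U j) μ := fun j => (hU j).aemeasurable_fst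
  have hξm : ∀ j, AEMeasurable (ξ j) μ := fun j => (hξ j).aemeasurable
  have hUm' : AEMeasurable (fun ω j => U j ω) μ := aemeasurable_pi_lambda _ hUm
  have hξm' : AEMeasurable (fun ω j => ξ j ω) μ := aemeasurable_pi_lambda _ hξm
  have hlaw : μ.map (fun ω => ((fun j => U j ω), (fun j => ξ j ω))) =
      (Measure.pi fun _ : Fin N => μ.map fun ω => (X ω, G ω)).prod
        (Measure.pi fun _ : Fin N => FairPost.ditherLaw u) := by
    rw [(indepFun_iff_map_prod_eq_prod_map_map hUm' hξm').1 hUξ,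
      (iIndepFun_iff_map_fun_eq_pi_map hUm).1 hUi, (iIndepFun_iff_map_fun_eq_pi_map hξm).1 hξi]
    simp only [fun j => (hU j).map_eq, fun j => (hξ j).map_eq]
  have hcond := FairPost.condDistrib_ae_eq_const hLm (hUm'.prodMk hξm') hLUξ
  filter_upwards [hcond] with D hD hreg
  rw [hD, Kernel.const_apply, hlaw]
  have hπ : ∀ s, πmin ≤ FairPost.groupProb μ G s := fun s => hmin.2 ⟨s, rfl⟩
  have hπ0 : ∀ s, 0 < FairPost.groupProb μ G s := fun s => hπmin.trans_le (hπ s)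
  -- With `c = 16 |S|`, this level makes each group fail with probability at most `δ / |S|`.
  set a : ℝ := √(32 * N * Real.log (c / δ)) with ha
  have hcδ : 1 < c / δ := by rw [lt_div_iff₀ hδ.1]; linarith [hδ.2]
  have hlog : 0 < Real.log (c / δ) := Real.log_pos hcδ
  have ha0 : 0 < a := Real.sqrt_pos.2 (by positivity)
  have hexp : 16 * Real.exp (-(a ^ 2) / (32 * N)) = δ / Fintype.card S := by
    have h1 : -(a ^ 2) / (32 * N) = -Real.log (c / δ) := by
      rw [ha, Real.sq_sqrt (by positivity)]
      field_simp
    have hδ0 := hδ.1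
    rw [h1, Real.exp_neg, Real.exp_log (by positivity), hc]
    field_simp
  have hdev := fun s => FairPost.measure_groupDeviation_le (μ := μ) (N := N) hX hG A u s (hfhat D s) ha0
  rw [hexp] at hdev
  -- The failure event quantifies over all predictors and need not be measurable; monotonicity of
  -- the outer measure suffices. The deviation events depend on no predictor, hence the bound is
  -- simultaneous.
  refine (measure_mono (t := ⋃ s, _) fun w hw => ?_).trans
    ((measure_iUnion_fintype_le _ _).trans ((Finset.sum_le_sum fun s _ => hdev s).trans ?_))
  · by_contra hcon
    simp only [Set.mem_iUnion, Set.mem_ofPred_eq, not_exists, not_not] at hcon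
    refine hw fun g hg => ?_
    have : Nonempty (Fin M) := ⟨⟨0, hM⟩⟩
    refine ciSup_le fun s => ciSup_le fun m => ?_
    have hprob := FairPost.isProbabilityMeasure_groupLaw (G := G) (μ := μ) hX u (hπ0 s)
    have h1 := FairPost.abs_measureReal_sub_le hN hK hl01 hzA hg s m (FairPost.groupLaw μ X G u s)
      (FairPost.continuous_measureReal_dithered hX (hfhat D s) (hπ0 s) hreg) (hπ0 s)
      (hcon s).1 (hcon s).2
    have h2 : |(FairPost.groupLaw μ X G u s).real {p | g p.1 s p.2 ≤ z m} - l m| ≤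
        2 * a / (N * πmin) := by
      rw [le_div_iff₀ (by positivity), mul_comm]
      refine le_trans ?_ h1
      have := hπ s
      gcongr
    refine h2.trans ((FairPost.two_mul_div_le hN0 (by linarith) hδ.1 hδ.2 hπmin).trans ?_)
    have hK2 : (0 : ℝ) ≤ (K : ℝ) ^ 2 / N := by positivity
    refine mul_le_mul_of_nonneg_left ?_ (by positivity)
    linarith
  · rw [Finset.sum_const, Finset.card_univ, nsmul_eq_mul, ← ENNReal.ofReal_natCast,
      ← ENNReal.ofReal_mul (by positivity)]
    exact ENNReal.ofReal_le_ofReal (le_of_eq (by field_simp))
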